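/- Let $R$ be an irreducible reduced crystallographic root system in an $\ell$-dimensional Euclidean space $V$ with inner product $(\cdot,\cdot)$, with simple roots $\alpha_1,\dots,\alpha_\ell$, simple coroots $\alpha_j^\vee = 2\alpha_j/(\alpha_j,\alpha_j)$, fundamental weights $\omega_1,\dots,\omega_\ell$ (so $(\omega_i,\alpha_j^\vee)=\delta_{ij}$), and Weyl group $W$. Fix integers $m_1,\dots,m_\ell\ge 0$ and put $\omega=\sum_j m_j\omega_j$ and $\theta_j=(\omega_j,\omega)$. Let $\kappa\geq 0$ be the greatest common divisor of the numbers $(\omega,\alpha_r)$, $r=1,\dots,\ell$, i.e. the largest positive real number of which all of them are integral multiples (such a number exists if $\omega\neq 0$; put $\kappa=0$ if $\omega=0$). For $x=(x^1,\dots,x^\ell)\in\mathbb R^\ell$ and $c\in\mathbb R$ put $\mathbf x=c\,\omega+\sum_j x^j\alpha_j^\vee\in V$. The affine Weyl group $W_a(R)$ consists of the maps $g:\mathbf v\mapsto\sigma(\mathbf v)+\sum_j k_j\alpha_j^\vee$ of $V$, with $\sigma\in W$ and $k_j\in\mathbb Z$; it acts on the coordinates by $g(x;c)=(\tilde x;c)$,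 where $g\bigl(c\,\omega+\sum_j x^j\alpha_j^\vee\bigr)=c\,\omega+\sum_j\tilde x^j\alpha_j^\vee$. Let $\mathscr F$ be the ring of functions of $(x;c)\in\mathbb R^\ell\times\mathbb R$ that are complex linear combinations of functions $e^{2\pi i(t_0c+t_1x^1+\dots+t_\ell x^\ell)}$ with $t_0,\dots,t_\ell\in\mathbb R$, and let $\mathscr F^W$ be the subring of those $f\in\mathscr F$ with $f\circ g=f$ for all $g\in W_a(R)$. Let $\lambda=e^{-2\pi i\kappa c}$, let $\mathscr A=\mathbb C[\lambda,\,e^{2\pi i x^j},e^{-2\pi i x^j}\mid 1\le j\le\ell]\subset\mathscr F$ and let $\mathscr A^W=\mathscr A\cap\mathscr F^W$. For $j=1,\dots,\ell$ let $$y^j=e^{-2\pi i\theta_jc}\,\frac1{N_j}\sum_{\sigma\in W}e^{2\pi i(\omega_j,\sigma(\mathbf x))},\qquad N_j=\#\{\sigma\in W\mid\sigma(\omega_j)=\omega_j\}.$$ Then $\mathscr A^W=\mathbb C[y^1,\dots,y^\ell;\lambda]$, that is, $\mathscr A^W$ is the $\mathbb C$-subalgebra of $\mathscr F$ generated by $y^1,\dots,y^\ell$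 and $\lambda$. Moreover $y^1,\dots,y^\ell$ are algebraically independent over $\mathbb C$, and if $\omega\neq 0$, then $y^1,\dots,y^\ell,\lambda$ are algebraically independent over $\mathbb C$, so that $\mathscr A^W$ is a polynomial ring in these $\ell+1$ elements. (If $\omega=0$, then $\lambda=1$.) -/

import Mathlib

open scoped RealInnerProductSpace

noncomputable section

namespace LambdaFourier

variable {ι V : Type*} [NormedAddCommGroup V] [InnerProductSpace ℝ V]

/-- The root pairing `P` is a root system in the Euclidean space `V` in the usual sense: the roots
and the coroots both live in `V`, they are paired by the inner product, and the coroot of a root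
`α` is `2 α / (α, α)`. -/
structure IsEuclidean (P : RootPairing ι ℝ V V) : Prop where
  pairing_eq : ∀ v w : V, P.toLinearMap v w = ⟪v, w⟫
  coroot_eq : ∀ i : ι, P.coroot i = (2 / ⟪P.root i, P.root i⟫) • P.root i

variable {P : RootPairing ι ℝ V V}

/-- The Weyl group `W`, acting on `V`: it is generated by the simple reflections. -/
def weylGroup (b : P.Base) : Subgroup (V ≃ₗ[ℝ] V) :=
  Subgroup.closure (Set.range fun j : b.support => P.reflection j)

/-- The affine Weyl group, as the set of transformations `v ↦ σ v + ∑ k_j α_j^∨` of `V`, where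
`σ ∈ W` and the `k_j` are integers. -/
def affineWeylGroup (b : P.Base) : Set (V → V) :=
  {g | ∃ σ ∈ weylGroup b, ∃ k : b.support → ℤ,
    ∀ v, g v = σ v + ∑ j, (k j : ℝ) • P.coroot j}

lemma weylGroup_root_mem (b : P.Base) {σ : V ≃ₗ[ℝ] V} (hσ : σ ∈ weylGroup b) :
    ∀ i, σ (P.root i) ∈ Set.range P.root := by
  have key : ∀ j : b.support, ∀ i, P.reflection j (P.root i) ∈ Set.range P.root :=
    fun j i => P.mapsTo_reflection_root j ⟨i, rfl⟩
  induction hσ using Subgroup.closure_induction'' with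
  | one => exact fun i => ⟨i, rfl⟩
  | mem x hx =>
    obtain ⟨j, rfl⟩ := hx
    exact key j
  | inv_mem x hx =>
    obtain ⟨j, rfl⟩ := hx
    exact key j
  | mul x y _ _ hx hy =>
    intro i
    obtain ⟨k, hk⟩ := hy i
    rw [LinearEquiv.mul_apply, ← hk]
    exact hx k

instance finite_weylGroup [Finite ι] [P.IsRootSystem] (b : P.Base) : Finite (weylGroup b) := by
  let f : weylGroup b → (ι → Set.range P.root) :=
    fun σ i => ⟨(σ : V ≃ₗ[ℝ] V) (P.root i), weylGroup_root_mem b σ.2 i⟩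
  refine Finite.of_injective f fun σ τ h => ?_
  apply Subtype.ext
  apply LinearEquiv.toLinearMap_injective
  refine LinearMap.ext_on_range (v := P.root)
    (RootPairing.IsRootSystem.span_root_eq_top (P := P)) fun i => ?_
  exact congrArg Subtype.val (congrFun h i)

instance fintypeWeylGroup [Finite ι] [P.IsRootSystem] (b : P.Base) : Fintype (weylGroup b) :=
  Fintype.ofFinite _

/-- The fundamental weights: the basis of `V` dual to the simple coroots. -/
def fundamentalWeight [P.IsRootSystem] (b : P.Base) (j : b.support) : V :=
  P.toPerfPair.symm (b.toCoweightBasis.coord j)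

lemma inner_fundamentalWeight_coroot [P.IsRootSystem] (hP : IsEuclidean P) (b : P.Base)
    [DecidableEq b.support] (i j : b.support) :
    ⟪fundamentalWeight b i, P.coroot j⟫ = if i = j then (1 : ℝ) else 0 := by
  rw [← hP.pairing_eq, fundamentalWeight, ← RootPairing.Base.toCoweightBasis_apply b j,
    ← LinearMap.toPerfPair_apply, LinearEquiv.apply_symm_apply]
  simp [Finsupp.single_apply, eq_comm]

/-- The dominant weight `ω = ∑ m_j ω_j`. -/
def weight [P.IsRootSystem] (b : P.Base) (m : b.support → ℕ) : V :=
  ∑ j, (m j : ℝ) • fundamentalWeight b j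

/-- `θ_j = (ω_j, ω)`. -/
def theta [P.IsRootSystem] (b : P.Base) (m : b.support → ℕ) (j : b.support) : ℝ :=
  ⟪fundamentalWeight b j, weight b m⟫

/-- `κ`, the greatest common divisor of the nonnegative numbers `(ω, α_r)`: the largest positive
real number of which all of them are integral multiples. If `ω = 0`, every positive number is a
common divisor, and the supremum of this unbounded set is `0`, the usual value of the greatest
common divisor of zeros. -/
def kappa [P.IsRootSystem] (b : P.Base) (m : b.support → ℕ) : ℝ :=
  sSup {d : ℝ | 0 < d ∧ ∀ r : b.support, ∃ n : ℕ, ⟪weight b m, P.root r⟫ = n * d}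

/-- The space of the affine coordinates `(x; c)`. -/
abbrev Coord (b : P.Base) : Type _ := (b.support → ℝ) × ℝ

/-- The point `c ω + ∑ x_j α_j^∨` of `V` with affine coordinates `(x; c)`. -/
def point [P.IsRootSystem] (b : P.Base) (m : b.support → ℕ) (p : Coord b) : V :=
  p.2 • weight b m + ∑ j, p.1 j • P.coroot j

/-- The change of affine coordinates `(x; c) ↦ (x'; c)` that a transformation `g` of `V` yields:
`x'` is given by `g (c ω + ∑ x_j α_j^∨) = c ω + ∑ x'_j α_j^∨`. -/
def coordMap [P.IsRootSystem] (b : P.Base) (m : b.support → ℕ) (g : V → V) (p : Coord b) :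
    Coord b :=
  (b.toCoweightBasis.equivFun (g (point b m p) - p.2 • weight b m), p.2)

lemma point_coordMap [P.IsRootSystem] (b : P.Base) (m : b.support → ℕ) (g : V → V)
    (p : Coord b) : point b m (coordMap b m g p) = g (point b m p) := by
  have h := b.toCoweightBasis.sum_equivFun (g (point b m p) - p.2 • weight b m)
  simp only [RootPairing.Base.toCoweightBasis_apply] at h
  rw [point, coordMap, h, add_sub_cancel]

/-- The function `exp (2πi (t₀ c + ∑ t_j x_j))`. -/
def expFun (b : P.Base) (t₀ : ℝ) (t : b.support → ℝ) : Coord b → ℂ :=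
  fun p => Complex.exp (2 * Real.pi * Complex.I * ((t₀ * p.2 + ∑ j, t j * p.1 j : ℝ) : ℂ))

lemma expFun_zero (b : P.Base) : expFun b 0 0 = 1 := by
  funext p
  simp [expFun]

lemma expFun_mul (b : P.Base) (s₀ t₀ : ℝ) (s t : b.support → ℝ) :
    expFun b s₀ s * expFun b t₀ t = expFun b (s₀ + t₀) (s + t) := by
  funext p
  simp only [expFun, Pi.mul_apply, Pi.add_apply, ← Complex.exp_add]
  congr 1
  rw [← mul_add, ← Complex.ofReal_add]
  congr 2
  simp only [add_mul, Finset.sum_add_distrib]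
  ring

/-- The Fourier function ring `ℱ`: the linear span over `ℂ` of all the functions
`exp (2πi (t₀ c + ∑ t_j x_j))` with real `t₀`, `t_j`. -/
def fourierRing (b : P.Base) : Subalgebra ℂ (Coord b → ℂ) :=
  (Submodule.span ℂ (Set.range fun t : ℝ × (b.support → ℝ) => expFun b t.1 t.2)).toSubalgebra
    (Submodule.subset_span ⟨(0, 0), expFun_zero b⟩)
    (fun f g hf hg => by
      refine Submodule.span_induction₂ (p := fun f g _ _ => f * g ∈ Submodule.span ℂ _)
        ?_ ?_ ?_ ?_ ?_ ?_ ?_ hf hg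
      · rintro _ _ ⟨s, rfl⟩ ⟨t, rfl⟩
        exact Submodule.subset_span ⟨s + t, (expFun_mul b s.1 t.1 s.2 t.2).symm⟩
      · intro y _
        simp
      · intro x _
        simp
      · intro x y z _ _ _ hx hy
        rw [add_mul]
        exact add_mem hx hy
      · intro x y z _ _ _ hx hy
        rw [mul_add]
        exact add_mem hx hy
      · intro r x y _ _ h
        rw [smul_mul_assoc]
        exact Submodule.smul_mem _ r h
      · intro r x y _ _ h
        rw [mul_smul_comm]
        exact Submodule.smul_mem _ r h)

/-- The ring `ℱ^W` of the elements of `ℱ` that are invariant under the affine Weyl group. -/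
def invariantFourierRing [P.IsRootSystem] (b : P.Base) (m : b.support → ℕ) :
    Subalgebra ℂ (Coord b → ℂ) where
  carrier := {f | f ∈ fourierRing b ∧ ∀ g ∈ affineWeylGroup b, f ∘ coordMap b m g = f}
  mul_mem' := by
    rintro f₁ f₂ ⟨h₁, h₁'⟩ ⟨h₂, h₂'⟩
    refine ⟨mul_mem h₁ h₂, fun g hg => ?_⟩
    rw [Pi.mul_comp, h₁' g hg, h₂' g hg]
  add_mem' := by
    rintro f₁ f₂ ⟨h₁, h₁'⟩ ⟨h₂, h₂'⟩
    refine ⟨add_mem h₁ h₂, fun g hg => ?_⟩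
    rw [Pi.add_comp, h₁' g hg, h₂' g hg]
  algebraMap_mem' := fun r => ⟨algebraMap_mem _ r, fun _ _ => rfl⟩

/-- `λ = exp (-2πi κ c)`, as a function of the affine coordinates. -/
def lam [P.IsRootSystem] (b : P.Base) (m : b.support → ℕ) : Coord b → ℂ :=
  fun p => Complex.exp (-2 * Real.pi * Complex.I * ((kappa b m * p.2 : ℝ) : ℂ))

/-- The `λ`-Fourier polynomial ring `𝒜 = ℂ[λ, exp (2πi x_j), exp (-2πi x_j)]`. -/
def lambdaFourierRing [P.IsRootSystem] (b : P.Base) (m : b.support → ℕ) :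
    Subalgebra ℂ (Coord b → ℂ) :=
  Algebra.adjoin ℂ ({lam b m} ∪
    (Set.range (fun (j : b.support) (p : Coord b) =>
      Complex.exp (2 * Real.pi * Complex.I * (p.1 j : ℂ))) ∪
    Set.range (fun (j : b.support) (p : Coord b) =>
      Complex.exp (-2 * Real.pi * Complex.I * (p.1 j : ℂ)))))

/-- The ring `𝒜^W = 𝒜 ∩ ℱ^W` of invariant `λ`-Fourier polynomials. -/
def invariantLambdaFourierRing [P.IsRootSystem] (b : P.Base) (m : b.support → ℕ) :
    Subalgebra ℂ (Coord b → ℂ) :=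
  lambdaFourierRing b m ⊓ invariantFourierRing b m

/-- The orbit sum `Y_j = N_j⁻¹ ∑_{σ ∈ W} exp (2πi (ω_j, σ(c ω + ∑ x_r α_r^∨)))`, where `N_j` is the
order of the stabilizer of `ω_j` in `W`. -/
def orbitSum [Finite ι] [P.IsRootSystem] (b : P.Base) (m : b.support → ℕ) (j : b.support) :
    Coord b → ℂ :=
  fun p => (1 / (Nat.card {σ : weylGroup b //
      (σ : V ≃ₗ[ℝ] V) (fundamentalWeight b j) = fundamentalWeight b j} : ℂ)) *
    ∑ σ : weylGroup b, Complex.exp (2 * Real.pi * Complex.I *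
      ((⟪fundamentalWeight b j, (σ : V ≃ₗ[ℝ] V) (point b m p)⟫ : ℝ) : ℂ))

/-- The twisted orbit sum `y_j = exp (-2πi θ_j c) Y_j`. -/
def basicGenerator [Finite ι] [P.IsRootSystem] (b : P.Base) (m : b.support → ℕ)
    (j : b.support) : Coord b → ℂ :=
  fun p => Complex.exp (-2 * Real.pi * Complex.I * ((theta b m j * p.2 : ℝ) : ℂ)) *
    orbitSum b m j p

end LambdaFourier

end

/-! Expanded in the characters of `x`, a λ-Fourier polynomial is an element of the group algebra of
the weight lattice over the ring `ℂ[λ]` of functions of `c`. This representation (`toFunction`) is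
faithful, because characters are linearly independent at each fixed `c`. In it the theorem is a
twisted form of the classical one on exponential invariants of a Weyl group: a triangularity
argument with respect to a height.

The height of a weight is its pairing with the sum of the positive coroots, so every simple root has
height 2 (`exists_height`). The weights `σ⁻¹ ω_j` arise from `ω_j` by subtracting sums of simple
roots (`sub_weylGroup_mem_closure`). Hence `y_j` has the single leading exponent `ω_j`; and since
`(ω, ω_j - σ⁻¹ ω_j)` is a natural multiple of `κ`, the factor `exp (-2πi θ_j c)` makes all
coefficients powers of `λ` with nonnegative exponent.

Conversely, a simple reflection permutes the exponents of an invariant element, up to nonvanishing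
factors in `c`. So an exponent of maximal height is dominant, that is, the leading exponent of a
monomial in the `y_j`. Subtracting such monomials lowers the height until nothing is left. Distinct
monomials in the `y_j` have distinct leading exponents, which gives independence over `ℂ[λ]`; if `ω
≠ 0`, then `κ > 0` and `λ` is transcendental over `ℂ`. -/

noncomputable section

namespace LambdaFourier

/-! ### Leading terms in monoid algebras graded by an integral height -/

section LeadingTerm

variable {R Λ I : Type*} [CommRing R] [AddCommMonoid Λ]

/-- The elements of a monoid algebra all of whose exponents have height less than `n`. -/
def lowerSubmodule (R : Type*) [CommRing R] (h : Λ →+ ℤ) (n : ℤ) :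
    Submodule R (AddMonoidAlgebra R Λ) where
  carrier := {f | ∀ a, f.coeff a ≠ 0 → h a < n}
  zero_mem' := fun a ha => absurd (by simp) ha
  add_mem' := fun {f g} hf hg a ha => by
    by_cases h₁ : f.coeff a = 0
    · refine hg a fun h₂ => ha ?_
      simp [h₁, h₂]
    · exact hf a h₁
  smul_mem' := fun r f hf a ha => hf a fun h₀ => ha (by simp [h₀])

variable {h : Λ →+ ℤ}

lemma lowerSubmodule_mono {m n : ℤ} (hmn : m ≤ n) :
    lowerSubmodule R h m ≤ lowerSubmodule R h n :=
  fun _ hf a ha => (hf a ha).trans_le hmn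

lemma single_mem_lowerSubmodule {a : Λ} {n : ℤ} (r : R) (ha : h a < n) :
    AddMonoidAlgebra.single a r ∈ lowerSubmodule R h n := by
  classical
  intro b hb
  rw [AddMonoidAlgebra.coeff_single, Finsupp.single_apply] at hb
  split_ifs at hb with hab
  · exact hab ▸ ha
  · exact absurd rfl hb

/-- Heights are integers, so two strict bounds gain one in the sum. This slack allows a leading
monomial, of height below `h a + 1`, to multiply lower terms without loss. -/
lemma mul_mem_lowerSubmodule {m n k : ℤ} {f g : AddMonoidAlgebra R Λ}
    (hf : f ∈ lowerSubmodule R h m) (hg : g ∈ lowerSubmodule R h n) (hk : m + n ≤ k + 1) :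
    f * g ∈ lowerSubmodule R h k := by
  classical
  intro a ha
  have h₁ := AddMonoidAlgebra.support_coeff_mul_subset f g (Finsupp.mem_support_iff.mpr ha)
  obtain ⟨x, hx, y, hy, rfl⟩ := Finset.mem_add.mp h₁
  have hx' := hf x (Finsupp.mem_support_iff.mp hx)
  have hy' := hg y (Finsupp.mem_support_iff.mp hy)
  rw [map_add]
  lia

/-- `f` is the sum of the monomial with exponent `a` and of monomials of lower height. -/
def HasLeadingTerm (h : Λ →+ ℤ) (f : AddMonoidAlgebra R Λ) (a : Λ) : Prop :=
  f - AddMonoidAlgebra.single a 1 ∈ lowerSubmodule R h (h a)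

lemma HasLeadingTerm.coeff_self {f : AddMonoidAlgebra R Λ} {a : Λ} (hf : HasLeadingTerm h f a) :
    f.coeff a = 1 := by
  by_contra hne
  refine lt_irrefl _ (hf a ?_)
  simpa [sub_eq_zero] using hne

lemma HasLeadingTerm.lt_of_coeff_ne_zero {f : AddMonoidAlgebra R Λ} {a b : Λ}
    (hf : HasLeadingTerm h f a) (hab : b ≠ a) (hb : f.coeff b ≠ 0) : h b < h a := by
  classical
  refine hf b ?_
  simpa [Finsupp.single_apply, hab.symm] using hb

lemma HasLeadingTerm.one : HasLeadingTerm h (1 : AddMonoidAlgebra R Λ) 0 := by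
  simp [HasLeadingTerm, AddMonoidAlgebra.one_def]

lemma HasLeadingTerm.mul {f g : AddMonoidAlgebra R Λ} {a b : Λ}
    (hf : HasLeadingTerm h f a) (hg : HasLeadingTerm h g b) :
    HasLeadingTerm h (f * g) (a + b) := by
  have key : f * g - AddMonoidAlgebra.single (a + b) 1 =
      AddMonoidAlgebra.single a 1 * (g - AddMonoidAlgebra.single b 1) +
      (f - AddMonoidAlgebra.single a 1) * AddMonoidAlgebra.single b 1 +
      (f - AddMonoidAlgebra.single a 1) * (g - AddMonoidAlgebra.single b 1) := by
    have : AddMonoidAlgebra.single (a + b) (1 : R) =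
        AddMonoidAlgebra.single a 1 * AddMonoidAlgebra.single b 1 := by
      simp [AddMonoidAlgebra.single_mul_single]
    rw [this]
    ring
  have ha : AddMonoidAlgebra.single a (1 : R) ∈ lowerSubmodule R h (h a + 1) :=
    single_mem_lowerSubmodule _ (lt_add_one _)
  have hb : AddMonoidAlgebra.single b (1 : R) ∈ lowerSubmodule R h (h b + 1) :=
    single_mem_lowerSubmodule _ (lt_add_one _)
  rw [HasLeadingTerm, key, map_add]
  exact add_mem (add_mem (mul_mem_lowerSubmodule ha hg (by lia))
    (mul_mem_lowerSubmodule hf hb (by lia))) (mul_mem_lowerSubmodule hf hg (by lia))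

lemma HasLeadingTerm.pow {f : AddMonoidAlgebra R Λ} {a : Λ} (hf : HasLeadingTerm h f a) (n : ℕ) :
    HasLeadingTerm h (f ^ n) (n • a) := by
  induction n with
  | zero => simpa using HasLeadingTerm.one
  | succ n ih => rw [pow_succ, succ_nsmul]; exact ih.mul hf

lemma HasLeadingTerm.prod {Y : I → AddMonoidAlgebra R Λ} {e : I → Λ}
    (hY : ∀ i, HasLeadingTerm h (Y i) (e i)) (k : I →₀ ℕ) :
    HasLeadingTerm h (k.prod fun i n => Y i ^ n) (k.sum fun i n => n • e i) := by
  classical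
  rw [Finsupp.prod, Finsupp.sum]
  induction k.support using Finset.induction_on with
  | empty => simpa using HasLeadingTerm.one
  | insert i s hi ih =>
    rw [Finset.prod_insert hi, Finset.sum_insert hi]
    exact ((hY i).pow _).mul ih

/-- Elements with linearly independent leading exponents are algebraically independent. -/
theorem algebraicIndependent_of_hasLeadingTerm {Y : I → AddMonoidAlgebra R Λ} {e : I → Λ}
    (hY : ∀ i, HasLeadingTerm h (Y i) (e i))
    (he : Function.Injective fun k : I →₀ ℕ => k.sum fun i n => n • e i) :
    AlgebraicIndependent R Y := by
  rw [algebraicIndependent_iff]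
  intro p hp
  by_contra hne
  -- At the leading exponent of a monomial `k` of maximal height no other monomial contributes: it
  -- could do so only by a lower term, and would then be higher than `k`.
  obtain ⟨k, hk, hmax⟩ := Finset.exists_max_image p.support
    (fun k => h (k.sum fun i n => n • e i)) (MvPolynomial.support_nonempty.mpr hne)
  refine MvPolynomial.mem_support_iff.mp hk ?_
  have h₀ := congrArg (fun f => f.coeff (k.sum fun i n => n • e i)) hp
  rw [p.as_sum, map_sum] at h₀
  simp only [MvPolynomial.aeval_monomial, AddMonoidAlgebra.coeff_sum, Finsupp.finsetSum_apply,
    AddMonoidAlgebra.coeff_zero, Finsupp.zero_apply, ← Algebra.smul_def,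
    AddMonoidAlgebra.coeff_smul, Finsupp.smul_apply] at h₀
  rwa [Finset.sum_eq_single_of_mem k hk, (HasLeadingTerm.prod hY k).coeff_self, smul_eq_mul,
    mul_one] at h₀
  intro v hv hvk
  by_contra h₁
  exact (hmax v hv).not_gt ((HasLeadingTerm.prod hY v).lt_of_coeff_ne_zero
    (fun h₂ => hvk (he h₂).symm) (right_ne_zero_of_smul h₁))

/-- A subalgebra in which the exponents of maximal height are sums of the leading exponents of
some of its elements is generated by these elements. -/
theorem le_adjoin_of_hasLeadingTerm {Y : I → AddMonoidAlgebra R Λ} {e : I → Λ}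
    (hY : ∀ i, HasLeadingTerm h (Y i) (e i)) (he : ∀ i, 0 ≤ h (e i))
    (B : Subalgebra R (AddMonoidAlgebra R Λ)) (hYB : ∀ i, Y i ∈ B)
    (hB : ∀ f ∈ B, ∀ a, f.coeff a ≠ 0 → (∀ b, f.coeff b ≠ 0 → h b ≤ h a) →
      ∃ k : I →₀ ℕ, a = k.sum fun i n => n • e i) :
    B ≤ Algebra.adjoin R (Set.range Y) := by
  classical
  have prod_mem : ∀ (C : Subalgebra R (AddMonoidAlgebra R Λ)), (∀ i, Y i ∈ C) →
      ∀ k : I →₀ ℕ, (k.prod fun i n => Y i ^ n) ∈ C := fun C hC k =>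
    prod_mem fun i _ => pow_mem (hC i) _
  have key : ∀ n : ℕ, ∀ f ∈ B, f ∈ lowerSubmodule R h n →
      f ∈ Algebra.adjoin R (Set.range Y) := by
    intro n
    induction n with
    | zero =>
      -- All exponents are of negative height, whereas a highest one would be a sum of leading
      -- exponents, of height at least 0. So `f = 0`.
      intro f hfB hf
      by_cases hne : f = 0
      · rw [hne]; exact zero_mem _
      · obtain ⟨a, ha, hmax⟩ := Finset.exists_max_image f.coeff.support h
          (by simpa [Finsupp.support_nonempty_iff] using hne)
        rw [Finsupp.mem_support_iff] at ha
        obtain ⟨k, rfl⟩ := hB f hfB a ha fun b hb => hmax b (Finsupp.mem_support_iff.mpr hb)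
        have h₁ := hf _ ha
        rw [map_finsuppSum] at h₁
        refine absurd h₁ (not_lt.mpr (Finset.sum_nonneg fun i _ => ?_))
        simp only [map_nsmul]
        exact nsmul_nonneg (he i) _
    | succ n ih =>
      intro f hfB hf
      have hdom : ∀ a, f.coeff a ≠ 0 → h a = n → ∃ k : I →₀ ℕ, a = k.sum fun i n => n • e i := by
        intro a ha hn
        refine hB f hfB a ha fun b hb => ?_
        have := hf b hb
        push_cast at this
        lia
      choose k hk using hdom
      -- `g` matches `f` at all exponents of height exactly `n` simultaneously.
      set g : AddMonoidAlgebra R Λ := ∑ a ∈ f.coeff.support,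
        if H : f.coeff a ≠ 0 ∧ h a = n then
          f.coeff a • ((k a H.1 H.2).prod fun i n => Y i ^ n) else 0 with hg
      -- Needed for `B`, to apply the induction hypothesis to `f - g`, and for the algebra generated
      -- by the `Y i`.
      have g_mem : ∀ (C : Subalgebra R (AddMonoidAlgebra R Λ)), (∀ i, Y i ∈ C) → g ∈ C := by
        intro C hC
        refine sum_mem fun a _ => ?_
        split_ifs with H
        · exact Subalgebra.smul_mem _ (prod_mem C hC _) _
        · exact zero_mem _
      have hsub : f - g ∈ lowerSubmodule R h n := by
        have hf' : f = ∑ a ∈ f.coeff.support, AddMonoidAlgebra.single a (f.coeff a) :=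
          f.sum_coeff_single.symm
        rw [hg]
        nth_rw 1 [hf']
        rw [← Finset.sum_sub_distrib]
        refine sum_mem fun a ha => ?_
        rw [Finsupp.mem_support_iff] at ha
        split_ifs with H
        · have h₁ := HasLeadingTerm.prod hY (k a H.1 H.2)
          rw [← hk a H.1 H.2] at h₁
          have h₂ := Submodule.smul_mem _ (-f.coeff a) (lowerSubmodule_mono H.2.le h₁)
          convert h₂ using 1
          simp [AddMonoidAlgebra.smul_single, sub_eq_add_neg, add_comm]
        · rw [sub_zero]
          refine single_mem_lowerSubmodule _ (lt_of_le_of_ne ?_ fun h₀ => H ⟨ha, h₀⟩)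
          have := hf a ha
          push_cast at this
          lia
      have := add_mem (ih (f - g) (sub_mem hfB (g_mem B hYB)) hsub)
        (g_mem _ fun i => Algebra.subset_adjoin ⟨i, rfl⟩)
      rwa [sub_add_cancel] at this
  intro f hf
  obtain ⟨n, hn⟩ : ∃ n : ℕ, ∀ a ∈ f.coeff.support, h a < n := by
    refine ⟨(f.coeff.support.sup fun a => (h a).toNat) + 1, fun a ha => ?_⟩
    have := Finset.le_sup (f := fun a => (h a).toNat) ha
    lia
  exact key n f hf fun a ha => hn a (Finsupp.mem_support_iff.mpr ha)

end LeadingTerm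

/-! ### Euclidean reflections, the exchange property and orbits of dominant weights -/

section RootSystem

variable {ι V : Type*} [NormedAddCommGroup V] [InnerProductSpace ℝ V]
  {P : RootPairing ι ℝ V V}

lemma inner_root_self_pos (P : RootPairing ι ℝ V V) (i : ι) : 0 < ⟪P.root i, P.root i⟫ :=
  real_inner_self_pos.mpr (P.ne_zero i)

lemma IsEuclidean.root_eq_smul_coroot (hP : IsEuclidean P) (i : ι) :
    P.root i = (⟪P.root i, P.root i⟫ / 2) • P.coroot i := by
  have h := (inner_root_self_pos P i).ne'
  rw [hP.coroot_eq, smul_smul, div_mul_div_comm, mul_comm, div_self (by positivity), one_smul]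

lemma IsEuclidean.inner_root_coroot (hP : IsEuclidean P) (i j : ι) :
    ⟪P.root i, P.coroot j⟫ = P.pairing i j := by
  rw [← hP.pairing_eq]
  rfl

lemma IsEuclidean.reflection_eq (hP : IsEuclidean P) (i : ι) (v : V) :
    P.reflection i v = v - ⟪v, P.coroot i⟫ • P.root i := by
  rw [RootPairing.reflection_apply, ← hP.pairing_eq]
  rfl

/-- Root and coroot are proportional and may trade places. In this form the displacement is along
the coroot, the direction measured by the coordinates `x`. -/
lemma IsEuclidean.reflection_eq' (hP : IsEuclidean P) (i : ι) (v : V) :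
    P.reflection i v = v - ⟪P.root i, v⟫ • P.coroot i := by
  rw [hP.reflection_eq, hP.coroot_eq, inner_smul_right, smul_smul,
    real_inner_comm (P.root i) v]
  congr 2
  ring

lemma IsEuclidean.inner_reflection (hP : IsEuclidean P) (i : ι) (v w : V) :
    ⟪P.reflection i v, P.reflection i w⟫ = ⟪v, w⟫ := by
  have h := (inner_root_self_pos P i).ne'
  rw [hP.reflection_eq, hP.reflection_eq, hP.coroot_eq]
  simp only [inner_sub_left, inner_sub_right, inner_smul_left, inner_smul_right, conj_trivial,
    real_inner_comm w]
  field_simp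
  ring

variable (b : P.Base)

lemma IsEuclidean.inner_weylGroup (hP : IsEuclidean P) {σ : V ≃ₗ[ℝ] V} (hσ : σ ∈ weylGroup b) :
    ∀ v w : V, ⟪σ v, σ w⟫ = ⟪v, w⟫ := by
  induction hσ using Subgroup.closure_induction with
  | one => exact fun v w => rfl
  | mem x hx =>
    obtain ⟨j, rfl⟩ := hx
    exact hP.inner_reflection j
  | inv x _ hx =>
    intro v w
    rw [← hx, ← LinearEquiv.mul_apply, ← LinearEquiv.mul_apply, mul_inv_cancel]
    rfl
  | mul x y _ _ hx hy =>
    intro v w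
    rw [LinearEquiv.mul_apply, LinearEquiv.mul_apply, hx, hy]

lemma IsEuclidean.inner_weylGroup_inv (hP : IsEuclidean P) {σ : V ≃ₗ[ℝ] V}
    (hσ : σ ∈ weylGroup b) (v w : V) : ⟪v, σ w⟫ = ⟪σ⁻¹ v, w⟫ := by
  rw [← hP.inner_weylGroup b hσ (σ⁻¹ v), ← LinearEquiv.mul_apply, mul_inv_cancel]
  rfl

lemma IsEuclidean.weylGroup_coroot_mem (hP : IsEuclidean P) {σ : V ≃ₗ[ℝ] V}
    (hσ : σ ∈ weylGroup b) (i : ι) : ∃ k, P.root k = σ (P.root i) ∧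
      P.coroot k = σ (P.coroot i) := by
  obtain ⟨k, hk⟩ := weylGroup_root_mem b hσ i
  refine ⟨k, hk, ?_⟩
  rw [hP.coroot_eq, hP.coroot_eq i, map_smul, hk, hP.inner_weylGroup b hσ]

/-- The product of the simple reflections of a word. -/
def wordProd (L : List b.support) : V ≃ₗ[ℝ] V := (L.map fun j : b.support => P.reflection j).prod

lemma wordProd_mem (L : List b.support) : wordProd b L ∈ weylGroup b := by
  refine list_prod_mem fun x hx => ?_
  obtain ⟨j, -, rfl⟩ := List.mem_map.mp hx
  exact Subgroup.subset_closure ⟨j, rfl⟩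

lemma exists_wordProd_eq {σ : V ≃ₗ[ℝ] V} (hσ : σ ∈ weylGroup b) :
    ∃ L : List b.support, wordProd b L = σ := by
  induction hσ using Subgroup.closure_induction'' with
  | one => exact ⟨[], rfl⟩
  | mem x hx =>
    obtain ⟨j, rfl⟩ := hx
    exact ⟨[j], by simp [wordProd]⟩
  | inv_mem x hx =>
    obtain ⟨j, rfl⟩ := hx
    exact ⟨[j], by simp [wordProd]⟩
  | mul x y _ _ hx hy =>
    obtain ⟨L, rfl⟩ := hx
    obtain ⟨L', rfl⟩ := hy
    exact ⟨L ++ L', by simp [wordProd]⟩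

lemma IsEuclidean.reflection_mul_eq (hP : IsEuclidean P) {σ : V ≃ₗ[ℝ] V} (hσ : σ ∈ weylGroup b)
    {i k : ι} (hk : P.root k = σ (P.root i)) : P.reflection k * σ = σ * P.reflection i := by
  obtain ⟨k', h₁, h₂⟩ := hP.weylGroup_coroot_mem b hσ i
  obtain rfl : k' = k := P.root.injective (h₁.trans hk.symm)
  ext v
  rw [LinearEquiv.mul_apply, LinearEquiv.mul_apply, hP.reflection_eq, hP.reflection_eq, h₁, h₂,
    hP.inner_weylGroup b hσ, map_sub, map_smul]

variable [Finite ι] [P.IsCrystallographic] [P.IsReduced]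

/-- The exchange property of the Weyl group. -/
lemma IsEuclidean.exists_wordProd_mul_reflection (hP : IsEuclidean P) (L : List b.support)
    (r : b.support) (i : ι) (hi : P.root i = wordProd b L (P.root r)) (hneg : ¬ b.IsPos i) :
    ∃ L' : List b.support, L'.length < L.length ∧
      wordProd b L' = wordProd b L * P.reflection r := by
  induction L generalizing i with
  | nil =>
    obtain rfl : i = r := P.root.injective hi
    exact absurd (RootPairing.Base.isPos_of_mem_support r.2) hneg
  | cons a L ih =>
    obtain ⟨k, hk⟩ := weylGroup_root_mem b (wordProd_mem b L) r
    have hcons : wordProd b (a :: L) = P.reflection a * wordProd b L := by simp [wordProd]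
    -- A simple reflection makes no positive root negative except its own. So if `k` is positive, it
    -- is `a`, and conjugation turns `s_a w` into `w s_r`: the letter `a` can be deleted. Otherwise
    -- the sign changes further inside the word.
    by_cases hpos : b.IsPos k
    · have hik : i = P.reflectionPerm a k := by
        apply P.root.injective
        rw [hi, hcons, RootPairing.root_reflectionPerm, hk]
        rfl
      by_cases hka : k = a
      · subst hka
        refine ⟨L, by simp, ?_⟩
        rw [hcons, hP.reflection_mul_eq b (wordProd_mem b L) hk, mul_assoc, ← sq,
          RootPairing.reflection_sq, mul_one]
      · exact absurd (hik ▸ hpos.reflectionPerm a.2 hka) hneg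
    · obtain ⟨L', hL', h⟩ := ih k hk hpos
      refine ⟨a :: L', by simpa using hL', ?_⟩
      rw [hcons, mul_assoc, ← h]
      simp [wordProd]

omit [Finite ι] [P.IsCrystallographic] [P.IsReduced] in
lemma root_mem_closure_of_isPos {i : ι} (hi : b.IsPos i) :
    P.root i ∈ AddSubmonoid.closure (Set.range fun j : b.support => P.root j) := by
  obtain ⟨f, -, h | h⟩ := b.exists_root_eq_sum_nat_or_neg i
  · rw [h]
    exact sum_mem fun j hj => nsmul_mem (AddSubmonoid.subset_closure
      (Set.mem_range_self (⟨j, hj⟩ : b.support))) _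
  · have h' : P.root i = ∑ j ∈ b.support, (fun j => -(f j : ℤ)) j • P.root j := by
      rw [h, ← Finset.sum_neg_distrib]
      simp
    rw [RootPairing.Base.isPos_iff, RootPairing.Base.height_eq_sum h', Finset.sum_neg_distrib] at hi
    have : 0 ≤ ∑ j ∈ b.support, (f j : ℤ) := Finset.sum_nonneg fun _ _ => by positivity
    lia

/-- A dominant weight is the highest element of its orbit under the Weyl group. -/
theorem IsEuclidean.sub_weylGroup_mem_closure (hP : IsEuclidean P) {μ : V} {k : b.support → ℕ}
    (hμ : ∀ j : b.support, ⟪μ, P.coroot j⟫ = k j) {σ : V ≃ₗ[ℝ] V} (hσ : σ ∈ weylGroup b) :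
    μ - σ μ ∈ AddSubmonoid.closure (Set.range fun j : b.support => P.root j) := by
  obtain ⟨L, rfl⟩ := exists_wordProd_eq b hσ
  clear hσ
  induction hn : L.length using Nat.strong_induction_on generalizing L with
  | _ n ih =>
    obtain rfl | ⟨L₀, r, rfl⟩ := L.eq_nil_or_concat'
    · simp [wordProd]
    · have hprod : wordProd b (L₀ ++ [r]) = wordProd b L₀ * P.reflection r := by simp [wordProd]
      have hlen : L₀.length < n := by
        rw [← hn]
        simp
      obtain ⟨i, hi⟩ := weylGroup_root_mem b (wordProd_mem b L₀) r
      -- With `w` the shorter word, `μ - w s_r μ = (μ - w μ) + k_r w α_r`. If `w α_r` is negative,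
      -- the exchange property replaces `w s_r` by a word shorter than `w`.
      by_cases hpos : b.IsPos i
      · have h₁ : μ - wordProd b (L₀ ++ [r]) μ = (μ - wordProd b L₀ μ) + k r • P.root i := by
          rw [hprod, LinearEquiv.mul_apply, hP.reflection_eq, hμ, map_sub, map_smul, hi,
            Nat.cast_smul_eq_nsmul]
          abel
        rw [h₁]
        exact add_mem (ih _ hlen L₀ rfl) (nsmul_mem (root_mem_closure_of_isPos b hpos) _)
      · obtain ⟨L', hL', h⟩ := hP.exists_wordProd_mul_reflection b L₀ r i hi hpos
        rw [hprod, ← h]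
        exact ih _ (hL'.trans hlen) L' rfl

end RootSystem

/-! ### Fundamental weights and the height -/

section Weights

variable {ι V : Type*} [NormedAddCommGroup V] [InnerProductSpace ℝ V]
  {P : RootPairing ι ℝ V V} [P.IsRootSystem] (b : P.Base)

lemma IsEuclidean.coord_eq_inner (hP : IsEuclidean P) (j : b.support) (v : V) :
    b.toCoweightBasis.coord j v = ⟪fundamentalWeight b j, v⟫ := by
  rw [← hP.pairing_eq, fundamentalWeight, ← LinearMap.toPerfPair_apply,
    LinearEquiv.apply_symm_apply]

lemma IsEuclidean.sum_inner_smul_coroot (hP : IsEuclidean P) (v : V) :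
    ∑ j, ⟪fundamentalWeight b j, v⟫ • P.coroot j = v := by
  have h := b.toCoweightBasis.sum_repr v
  simpa only [← Module.Basis.coord_apply, hP.coord_eq_inner b,
    RootPairing.Base.toCoweightBasis_apply] using h

lemma IsEuclidean.inner_fundamentalWeight_root [DecidableEq b.support] (hP : IsEuclidean P)
    (j r : b.support) : ⟪fundamentalWeight b j, P.root r⟫ =
      if j = r then ⟪P.root r, P.root r⟫ / 2 else 0 := by
  rw [hP.root_eq_smul_coroot r, inner_smul_right, inner_fundamentalWeight_coroot hP,
    ← hP.root_eq_smul_coroot r]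
  simp

lemma IsEuclidean.inner_weight_root (hP : IsEuclidean P) (m : b.support → ℕ) (r : b.support) :
    ⟪weight b m, P.root r⟫ = m r * (⟪P.root r, P.root r⟫ / 2) := by
  classical
  simp [weight, sum_inner, inner_smul_left, hP.inner_fundamentalWeight_root b]

lemma IsEuclidean.exists_int_inner_coroot (hP : IsEuclidean P) (j : b.support) (i : ι) :
    ∃ z : ℤ, ⟪fundamentalWeight b j, P.coroot i⟫ = z := by
  classical
  have h := b.coroot_mem_span_int i
  generalize P.coroot i = x at h ⊢
  induction h using Submodule.span_induction with
  | mem x hx =>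
    obtain ⟨r, hr, rfl⟩ := hx
    have h₁ := inner_fundamentalWeight_coroot hP b j ⟨r, hr⟩
    refine ⟨if j = ⟨r, hr⟩ then 1 else 0, h₁.trans ?_⟩
    split_ifs <;> simp
  | zero => exact ⟨0, by simp⟩
  | add x y _ _ hx hy =>
    obtain ⟨z, hz⟩ := hx
    obtain ⟨z', hz'⟩ := hy
    exact ⟨z + z', by rw [inner_add_right, hz, hz']; push_cast; rfl⟩
  | smul a x _ hx =>
    obtain ⟨z, hz⟩ := hx
    exact ⟨a * z, by rw [← Int.cast_smul_eq_zsmul ℝ, inner_smul_right, hz]; push_cast; rfl⟩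

/-- The sum of the positive coroots is a linear combination of the simple coroots with positive
integral coefficients, and its pairing with every simple root is `2`. -/
theorem IsEuclidean.exists_height [Finite ι] [P.IsCrystallographic] [P.IsReduced]
    (hP : IsEuclidean P) : ∃ c : b.support → ℤ, (∀ j, 1 ≤ c j) ∧
      ∀ r : b.support, ∑ j : b.support, P.pairingIn ℤ r j * c j = 2 := by
  classical
  have := Fintype.ofFinite ι
  choose z hz using hP.exists_int_inner_coroot b
  have hnonneg : ∀ j i, b.IsPos i → 0 ≤ z j i := by
    intro j i hi
    have h₁ : 0 ≤ ⟪fundamentalWeight b j, P.root i⟫ := by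
      have h := root_mem_closure_of_isPos b hi
      generalize P.root i = x at h ⊢
      induction h using AddSubmonoid.closure_induction with
      | mem x hx =>
        obtain ⟨r, rfl⟩ := hx
        rw [hP.inner_fundamentalWeight_root]
        have := inner_root_self_pos P r
        split_ifs <;> positivity
      | zero => simp
      | add x y _ _ hx hy => rw [inner_add_right]; exact add_nonneg hx hy
    have h₂ : (0 : ℝ) ≤ z j i := by
      rw [← hz, hP.coroot_eq, inner_smul_right]
      have := inner_root_self_pos P i
      positivity
    exact_mod_cast h₂
  -- The coefficient of the sum of the positive coroots at `α_j^∨`. Its summands are nonnegative,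
  -- and the one from `α_j^∨` itself is 1.
  refine ⟨fun j : b.support => ∑ i with b.IsPos i, z j i, fun j => ?_, fun r => ?_⟩
  · have h₁ : z j j = 1 := by
      have := (hz j j).symm.trans (inner_fundamentalWeight_coroot hP b j j)
      simpa using this
    rw [← h₁]
    exact Finset.single_le_sum (f := fun i => z j i)
      (fun i hi => hnonneg j i (Finset.mem_filter.mp hi).2)
      (by simp [RootPairing.Base.isPos_of_mem_support j.2])
  · have hpair : ∀ i, ∑ j : b.support, P.pairing r j * z j i = P.pairing r i := by
      intro i
      rw [← hP.inner_root_coroot r i, ← hP.sum_inner_smul_coroot b (P.coroot i), inner_sum]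
      exact Finset.sum_congr rfl fun j _ => by
        rw [inner_smul_right, hP.inner_root_coroot, hz, mul_comm]
    -- The reflection in `α_r` permutes the other positive roots and changes the sign of their
    -- pairing with `α_r`, so these pairings cancel. Only `α_r` itself remains, with pairing 2.
    have hrest : ∑ i ∈ ({i | b.IsPos i} : Finset ι).erase r, P.pairing r i = 0 := by
      have h₁ : ∑ i ∈ ({i | b.IsPos i} : Finset ι).erase r, P.pairing r i =
          ∑ i ∈ ({i | b.IsPos i} : Finset ι).erase r, -P.pairing r i := by
        have hmem : ∀ i ∈ ({i | b.IsPos i} : Finset ι).erase r,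
            P.reflectionPerm r i ∈ ({i | b.IsPos i} : Finset ι).erase r := by
          intro i hi
          simp only [Finset.mem_erase, Finset.mem_filter, Finset.mem_univ, true_and] at hi ⊢
          refine ⟨fun h => ?_, hi.2.reflectionPerm r.2 hi.1⟩
          have h₂ : i = P.reflectionPerm r r :=
            (P.reflectionPerm_self r i).symm.trans (congrArg _ h)
          have h₃ := (RootPairing.Base.IsPos.neg_iff_not b r).mp
          rw [RootPairing.indexNeg_neg] at h₃
          exact h₃ (h₂ ▸ hi.2) (RootPairing.Base.isPos_of_mem_support r.2)
        refine Finset.sum_nbij' (P.reflectionPerm r) (P.reflectionPerm r) hmem hmem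
          (fun i _ => by simp) (fun i _ => by simp) fun i _ => ?_
        rw [RootPairing.pairing_reflectionPerm, RootPairing.pairing_reflectionPerm_self_left,
          neg_neg]
      rw [Finset.sum_neg_distrib] at h₁
      linarith
    have h₄ : ∑ j : b.support, P.pairing r j * ((∑ i with b.IsPos i, z j i : ℤ) : ℝ) = 2 := by
      push_cast
      simp_rw [Finset.mul_sum]
      rw [Finset.sum_comm]
      simp_rw [hpair]
      rw [← Finset.add_sum_erase _ _ (a := (r : ι))
        (by simp [RootPairing.Base.isPos_of_mem_support r.2]), hrest]
      simp
    simp_rw [← P.algebraMap_pairingIn ℤ, eq_intCast] at h₄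
    exact_mod_cast h₄

end Weights

/-! ### Commensurability and the greatest common divisor `κ` -/

section Kappa

variable {ι V : Type*} [NormedAddCommGroup V] [InnerProductSpace ℝ V]
  {P : RootPairing ι ℝ V V}

/-- In an irreducible root system the ratios of the squared root lengths are rational. -/
theorem IsEuclidean.exists_rat_root_length [P.IsIrreducible] [P.IsCrystallographic]
    (hP : IsEuclidean P) (s j : ι) :
    ∃ q : ℚ, ⟪P.root j, P.root j⟫ = q * ⟪P.root s, P.root s⟫ := by
  -- For non-orthogonal roots the ratio of squared lengths is a quotient of two Cartan integers.
  have step : ∀ i j, P.pairing i j ≠ 0 →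
      ∃ q : ℚ, ⟪P.root j, P.root j⟫ = q * ⟪P.root i, P.root i⟫ := by
    intro i j hij
    have h₁ := hP.inner_root_coroot i j
    have h₂ := hP.inner_root_coroot j i
    rw [hP.coroot_eq, inner_smul_right] at h₁ h₂
    have hi := (inner_root_self_pos P i).ne'
    have hj := (inner_root_self_pos P j).ne'
    refine ⟨(P.pairingIn ℤ j i : ℚ) / (P.pairingIn ℤ i j : ℚ), ?_⟩
    have h₃ : ((P.pairingIn ℤ j i : ℤ) : ℝ) = P.pairing j i := P.algebraMap_pairingIn ℤ j i
    have h₄ : ((P.pairingIn ℤ i j : ℤ) : ℝ) = P.pairing i j := P.algebraMap_pairingIn ℤ i j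
    push_cast
    rw [h₃, h₄, div_mul_eq_mul_div, eq_div_iff hij, ← h₁, ← h₂]
    field_simp
    exact real_inner_comm _ _
  by_contra hne
  -- Roots outside the class of `s` are orthogonal to `U`, so `U` is stable under all reflections
  -- and irreducibility makes it the whole space. A root outside would then be orthogonal to itself.
  set U : Submodule ℝ V := Submodule.span ℝ (P.root ''
    {i | ∃ q : ℚ, ⟪P.root i, P.root i⟫ = q * ⟪P.root s, P.root s⟫}) with hU
  have horth : ∀ i k, (∃ q : ℚ, ⟪P.root i, P.root i⟫ = q * ⟪P.root s, P.root s⟫) →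
      (¬ ∃ q : ℚ, ⟪P.root k, P.root k⟫ = q * ⟪P.root s, P.root s⟫) →
      ⟪P.root i, P.coroot k⟫ = 0 := by
    rintro i k ⟨q, hq⟩ hk
    rw [hP.inner_root_coroot]
    by_contra h
    obtain ⟨q', hq'⟩ := step i k h
    exact hk ⟨q' * q, by rw [hq', hq]; push_cast; ring⟩
  have hperp : ∀ k, (¬ ∃ q : ℚ, ⟪P.root k, P.root k⟫ = q * ⟪P.root s, P.root s⟫) →
      ∀ v ∈ U, ⟪v, P.coroot k⟫ = 0 := by
    intro k hk v hv
    induction hv using Submodule.span_induction with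
    | mem x hx =>
      obtain ⟨i, hi, rfl⟩ := hx
      exact horth i k hi hk
    | zero => simp
    | add x y _ _ hx hy => rw [inner_add_left, hx, hy, add_zero]
    | smul a x _ hx => rw [inner_smul_left, hx, mul_zero]
  have htop : U = ⊤ := by
    refine RootPairing.IsIrreducible.eq_top_of_invtSubmodule_reflection (P := P) U (fun k => ?_) ?_
    · rw [Module.End.mem_invtSubmodule]
      intro v hv
      change P.reflection k v ∈ U
      rw [hP.reflection_eq]
      by_cases hk : ∃ q : ℚ, ⟪P.root k, P.root k⟫ = q * ⟪P.root s, P.root s⟫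
      · exact sub_mem hv (Submodule.smul_mem _ _ (Submodule.subset_span ⟨k, hk, rfl⟩))
      · rw [hperp k hk v hv, zero_smul, sub_zero]
        exact hv
    · rw [Submodule.ne_bot_iff]
      exact ⟨P.root s, Submodule.subset_span ⟨s, ⟨1, by simp⟩, rfl⟩, P.ne_zero s⟩
  have h := hperp j hne (P.root j) (htop ▸ Submodule.mem_top)
  rw [hP.inner_root_coroot, RootPairing.pairing_same] at h
  norm_num at h

/-- The supremum of the set of common divisors of nonnegative commensurable real numbers, not all
zero, is a common divisor. -/
theorem sSup_commonDivisor {I : Type*} [Fintype I] (a : I → ℝ) (s : I) (hs : 0 < a s)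
    (hq : ∀ r, ∃ q : ℚ, 0 ≤ q ∧ a r = q * a s) :
    sSup {d : ℝ | 0 < d ∧ ∀ r, ∃ n : ℕ, a r = n * d} ∈
      {d : ℝ | 0 < d ∧ ∀ r, ∃ n : ℕ, a r = n * d} := by
  classical
  set S := {d : ℝ | 0 < d ∧ ∀ r, ∃ n : ℕ, a r = n * d} with hS
  choose q hq₀ hq using hq
  -- The product of the denominators of the ratios provides one common divisor. The greatest one is
  -- that with the least quotient `a s / d`.
  have hne : ∃ n : ℕ, ∃ d ∈ S, a s = n * d := by
    have hpos : (0 : ℝ) < ((∏ r, (q r).den : ℕ) : ℝ) := by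
      exact_mod_cast Finset.prod_pos fun r _ => (q r).den_pos
    refine ⟨∏ r, (q r).den, a s / ((∏ r, (q r).den : ℕ) : ℝ), ⟨div_pos hs hpos, fun r => ?_⟩, ?_⟩
    · refine ⟨(q r).num.toNat * ∏ r ∈ Finset.univ.erase r, (q r).den, ?_⟩
      have h₁ : ((q r).num.toNat : ℝ) = ((q r : ℚ) : ℝ) * (q r).den := by
        have h₂ : ((q r).num.toNat : ℤ) = (q r).num :=
          Int.toNat_of_nonneg (Rat.num_nonneg.mpr (hq₀ r))
        have h₃ : ((q r).num.toNat : ℚ) = q r * (q r).den := by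
          rw [Rat.mul_den_eq_num]
          exact_mod_cast h₂
        exact_mod_cast h₃
      have h₄ := Finset.mul_prod_erase Finset.univ (fun r => (q r).den) (Finset.mem_univ r)
      rw [mul_div_assoc', eq_div_iff hpos.ne', hq r, ← h₄]
      push_cast
      rw [h₁]
      ring
    · rw [mul_div_cancel₀ _ hpos.ne']
  obtain ⟨d, hd, hn⟩ := Nat.find_spec hne
  have hmax : IsGreatest S d := by
    refine ⟨hd, fun d' hd' => ?_⟩
    obtain ⟨n', hn'⟩ := hd'.2 s
    have hle : (Nat.find hne : ℝ) ≤ n' := by exact_mod_cast Nat.find_min' hne ⟨d', hd', hn'⟩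
    by_contra! hlt
    have h₀ : 0 < (Nat.find hne : ℝ) := by
      by_contra! h
      have : (Nat.find hne : ℝ) * d ≤ 0 := mul_nonpos_of_nonpos_of_nonneg h hd.1.le
      linarith
    have : (Nat.find hne : ℝ) * d < n' * d' :=
      mul_lt_mul_of_lt_of_le_of_pos_of_nonneg hlt hle h₀ hd'.1.le |> fun h => by
        simpa [mul_comm] using h
    linarith
  rw [hmax.csSup_eq]
  exact hd

variable [P.IsRootSystem] (b : P.Base)

lemma weight_zero : weight b (0 : b.support → ℕ) = 0 := by
  simp [weight]

/-- `(ω, α_r) = m_r (α_r, α_r) / 2`, and irreducibility makes these numbers commensurable, so the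
supremum is attained. -/
lemma IsEuclidean.kappa_mem [P.IsIrreducible] [P.IsCrystallographic] (hP : IsEuclidean P)
    {m : b.support → ℕ} (hm : m ≠ 0) : 0 < kappa b m ∧
      ∀ r : b.support, ∃ n : ℕ, ⟪weight b m, P.root r⟫ = n * kappa b m := by
  obtain ⟨s, hs⟩ := Function.ne_iff.mp hm
  have hs' : (0 : ℝ) < m s := by exact_mod_cast Nat.pos_of_ne_zero hs
  have hroot := inner_root_self_pos P (s : ι)
  refine sSup_commonDivisor (fun r : b.support => ⟪weight b m, P.root r⟫) s ?_ fun r => ?_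
  · rw [hP.inner_weight_root]
    positivity
  · obtain ⟨q, hq⟩ := hP.exists_rat_root_length s r
    have hq₀ : 0 ≤ q := by
      have := inner_root_self_pos P (r : ι)
      rw [hq] at this
      exact_mod_cast (pos_of_mul_pos_left this hroot.le).le
    refine ⟨m r * q / m s, by positivity, ?_⟩
    rw [hP.inner_weight_root, hP.inner_weight_root, hq]
    push_cast
    field_simp

lemma IsEuclidean.exists_nat_inner_weight_root [P.IsIrreducible] [P.IsCrystallographic]
    (hP : IsEuclidean P) (m : b.support → ℕ) (r : b.support) :
    ∃ n : ℕ, ⟪weight b m, P.root r⟫ = n * kappa b m := by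
  by_cases hm : m = 0
  · subst hm
    exact ⟨0, by simp [weight_zero]⟩
  · exact (hP.kappa_mem b hm).2 r

end Kappa

/-! ### Characters and their linear independence -/

section Exponentials

/-- The function `exp (-2πi t c)` of `c`. -/
def twist (t : ℝ) : ℝ → ℂ :=
  fun c => Complex.exp (-2 * Real.pi * Complex.I * ((t * c : ℝ) : ℂ))

lemma twist_zero : twist 0 = 1 := by
  funext c
  simp [twist]

lemma twist_natCast_mul (n : ℕ) (t : ℝ) : twist (n * t) = twist t ^ n := by
  funext c
  rw [Pi.pow_apply, twist, twist, ← Complex.exp_nat_mul]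
  congr 1
  push_cast
  ring

variable {I : Type*} [Fintype I]

/-- The character `exp (2πi ∑ k_j x_j)` of `ℝ^I`. -/
def character (k : I → ℤ) : (I → ℝ) → ℂ :=
  fun x => Complex.exp (2 * Real.pi * Complex.I * ((∑ j, k j * x j : ℝ) : ℂ))

lemma character_zero : character (0 : I → ℤ) = 1 := by
  funext x
  simp [character]

lemma character_add (k l : I → ℤ) : character (k + l) = character k * character l := by
  funext x
  simp only [character, Pi.mul_apply, Pi.add_apply, ← Complex.exp_add]
  rw [← mul_add, ← Complex.ofReal_add, ← Finset.sum_add_distrib]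
  simp only [Int.cast_add, add_mul]

lemma character_eq_prod (k : I → ℤ) (x : I → ℝ) :
    character k x = ∏ j, Complex.exp (2 * Real.pi * Complex.I * (x j : ℂ)) ^ k j := by
  simp_rw [character, ← Complex.exp_int_mul]
  rw [← Complex.exp_sum]
  congr 1
  push_cast
  rw [Finset.mul_sum]
  exact Finset.sum_congr rfl fun j _ => by ring

lemma character_injective : Function.Injective (character : (I → ℤ) → (I → ℝ) → ℂ) := by
  classical
  intro k l h
  by_contra hne
  obtain ⟨j, hj⟩ := Function.ne_iff.mp hne
  have hj' : ((k j : ℂ) - l j) ≠ 0 := by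
    rw [sub_ne_zero]
    exact_mod_cast hj
  -- At this point the two characters differ by the factor `exp (πi) = -1`.
  have h₁ : ∀ n : I → ℤ, character n (Pi.single j (1 / (2 * ((k j : ℝ) - l j)))) =
      Complex.exp (Real.pi * Complex.I * (n j / ((k j : ℂ) - l j))) := by
    intro n
    rw [character, Finset.sum_eq_single j (fun i _ hi => by simp [hi]) (by simp)]
    congr 1
    simp only [Pi.single_eq_same]
    push_cast
    field_simp
  have h₂ := congrFun h (Pi.single j (1 / (2 * ((k j : ℝ) - l j))))
  rw [h₁, h₁] at h₂
  have h₃ : Complex.exp (Real.pi * Complex.I * (k j / ((k j : ℂ) - l j))) =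
      Complex.exp (Real.pi * Complex.I * (l j / ((k j : ℂ) - l j))) *
        Complex.exp (Real.pi * Complex.I) := by
    rw [← Complex.exp_add]
    congr 1
    field_simp
    ring
  rw [h₃, Complex.exp_pi_mul_I] at h₂
  have := Complex.exp_ne_zero (Real.pi * Complex.I * (l j / ((k j : ℂ) - l j)))
  refine this ?_
  linear_combination (-1 / 2 : ℂ) * h₂

/-- Dedekind's theorem, for the additive group `ℝ^I` written multiplicatively. -/
lemma linearIndependent_character :
    LinearIndependent ℂ (character : (I → ℤ) → (I → ℝ) → ℂ) := by
  let φ : (I → ℤ) → (Multiplicative (I → ℝ) →* ℂ) := fun k =>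
    { toFun := fun x => character k x.toAdd
      map_one' := by simp [character]
      map_mul' := fun x y => by
        simp only [character, toAdd_mul, Pi.add_apply, ← Complex.exp_add]
        rw [← mul_add, ← Complex.ofReal_add, ← Finset.sum_add_distrib]
        simp only [mul_add] }
  have hφ : Function.Injective φ := fun k l h =>
    character_injective (funext fun x => DFunLike.congr_fun h (Multiplicative.ofAdd x))
  exact (linearIndependent_monoidHom (Multiplicative (I → ℝ)) ℂ).comp φ hφ

end Exponentials

/-! ### The group algebra over `ℂ[λ]` as a model of `𝒜` -/

section Model

variable {ι V : Type*} [NormedAddCommGroup V] [InnerProductSpace ℝ V]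
  {P : RootPairing ι ℝ V V} [P.IsRootSystem] (b : P.Base) (m : b.support → ℕ)

/-- The ring `ℂ[λ]`, as a ring of functions of `c`. -/
def lamRing : Subalgebra ℂ (ℝ → ℂ) := Algebra.adjoin ℂ {twist (kappa b m)}

lemma twist_kappa_mem_lamRing : twist (kappa b m) ∈ lamRing b m :=
  Algebra.subset_adjoin (Set.mem_singleton _)

lemma twist_mem_lamRing (n : ℕ) : twist (n * kappa b m) ∈ lamRing b m := by
  rw [twist_natCast_mul]
  exact Subalgebra.pow_mem _ (twist_kappa_mem_lamRing b m) n

/-- The inclusion of the functions of `c` into the functions of `(x; c)`. -/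
def sndHom : (ℝ → ℂ) →ₐ[ℂ] (Coord b → ℂ) :=
  AlgHom.pi fun p => Pi.evalAlgHom ℂ (fun _ : ℝ => ℂ) p.2

omit [P.IsRootSystem] in
@[simp] lemma sndHom_apply (f : ℝ → ℂ) (p : Coord b) : sndHom b f p = f p.2 := rfl

/-- The characters, as functions of `(x; c)`. -/
def characterHom : Multiplicative (b.support → ℤ) →* (Coord b → ℂ) where
  toFun k p := character k.toAdd p.1
  map_one' := by
    funext p
    simp [character_zero]
  map_mul' k l := by
    funext p
    simp [character_add]

/-- The `λ`-Fourier polynomials, as elements of the group algebra of the weight lattice over the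
ring `ℂ[λ]`. -/
def toFunction : AddMonoidAlgebra (lamRing b m) (b.support → ℤ) →ₐ[ℂ] (Coord b → ℂ) :=
  AddMonoidAlgebra.liftNCAlgHom ((sndHom b).comp (lamRing b m).val) (characterHom b)
    fun _ _ => Commute.all _ _

lemma toFunction_single (k : b.support → ℤ) (d : lamRing b m) :
    toFunction b m (AddMonoidAlgebra.single k d) =
      sndHom b d * characterHom b (Multiplicative.ofAdd k) :=
  AddMonoidAlgebra.liftNC_single _ _ _ _

/-- The coefficients at a given `c`. -/
def coeffAt (c : ℝ) (F : AddMonoidAlgebra (lamRing b m) (b.support → ℤ)) :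
    (b.support → ℤ) →₀ ℂ :=
  F.coeff.mapRange (fun d : lamRing b m => (d : ℝ → ℂ) c) rfl

lemma coeffAt_apply (c : ℝ) (F : AddMonoidAlgebra (lamRing b m) (b.support → ℤ))
    (k : b.support → ℤ) : coeffAt b m c F k = (F.coeff k : ℝ → ℂ) c :=
  Finsupp.mapRange_apply ..

/-- Freezing `c` makes the coefficients complex numbers, so that the independence of characters over
`ℂ` applies. -/
lemma toFunction_apply (F : AddMonoidAlgebra (lamRing b m) (b.support → ℤ)) (p : Coord b) :
    toFunction b m F p = Finsupp.linearCombination ℂ character (coeffAt b m p.2 F) p.1 := by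
  rw [coeffAt, Finsupp.linearCombination_apply, Finsupp.sum_mapRange_index (by simp)]
  conv_lhs => rw [← F.sum_coeff_single]
  rw [Finsupp.sum, Finsupp.sum, map_sum, Finset.sum_apply, Finset.sum_apply]
  refine Finset.sum_congr rfl fun k _ => ?_
  rw [toFunction_single]
  rfl

lemma coeffAt_eq_zero_iff (F : AddMonoidAlgebra (lamRing b m) (b.support → ℤ))
    (k : b.support → ℤ) : F.coeff k ≠ 0 ↔ ∃ c, coeffAt b m c F k ≠ 0 := by
  simp_rw [coeffAt_apply]
  rw [ne_eq, ← Subtype.coe_inj]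
  exact Function.ne_iff

lemma toFunction_injective : Function.Injective (toFunction b m) := by
  rw [injective_iff_map_eq_zero]
  intro F hF
  ext k : 2
  by_contra hne
  obtain ⟨c, hc⟩ := (coeffAt_eq_zero_iff b m F k).mp hne
  refine hc ?_
  have h := linearIndependent_character (I := b.support)
  rw [linearIndependent_iff] at h
  rw [h (coeffAt b m c F) ?_, Finsupp.zero_apply]
  funext x
  rw [← toFunction_apply b m F (x, c), hF]
  rfl

lemma sndHom_mem_adjoin (s : Set (Coord b → ℂ)) (hs : lam b m ∈ s) (d : lamRing b m) :
    sndHom b d ∈ Algebra.adjoin ℂ s := by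
  have h : lamRing b m ≤ (Algebra.adjoin ℂ s).comap (sndHom b) := by
    refine Algebra.adjoin_le ?_
    rintro _ rfl
    exact Algebra.subset_adjoin hs
  exact h d.2

lemma toFunction_mem (F : AddMonoidAlgebra (lamRing b m) (b.support → ℤ)) :
    toFunction b m F ∈ lambdaFourierRing b m := by
  rw [← F.sum_coeff_single, Finsupp.sum, map_sum]
  refine sum_mem fun k _ => ?_
  rw [toFunction_single]
  refine mul_mem (sndHom_mem_adjoin b m _ (Or.inl rfl) _) ?_
  have h : characterHom b (Multiplicative.ofAdd k) = ∏ j, fun p : Coord b =>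
      Complex.exp (2 * Real.pi * Complex.I * (p.1 j : ℂ)) ^ k j := by
    funext p
    rw [Finset.prod_apply]
    exact character_eq_prod k p.1
  rw [h]
  refine prod_mem fun j _ => ?_
  obtain ⟨n, hn | hn⟩ := (k j).eq_nat_or_neg
  · have h₁ : (fun p : Coord b => Complex.exp (2 * Real.pi * Complex.I * (p.1 j : ℂ)) ^ k j) =
        (fun p : Coord b => Complex.exp (2 * Real.pi * Complex.I * (p.1 j : ℂ))) ^ n := by
      funext p
      simp [hn]
    rw [h₁]
    have h₂ : (fun p : Coord b => Complex.exp (2 * Real.pi * Complex.I * (p.1 j : ℂ))) ∈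
        lambdaFourierRing b m := Algebra.subset_adjoin (Or.inr (Or.inl ⟨j, rfl⟩))
    exact pow_mem h₂ n
  · have h₁ : (fun p : Coord b => Complex.exp (2 * Real.pi * Complex.I * (p.1 j : ℂ)) ^ k j) =
        (fun p : Coord b => Complex.exp (-2 * Real.pi * Complex.I * (p.1 j : ℂ))) ^ n := by
      funext p
      simp only [hn, zpow_neg, zpow_natCast, Pi.pow_apply, ← inv_pow, ← Complex.exp_neg]
      congr 2
      ring
    rw [h₁]
    have h₂ : (fun p : Coord b => Complex.exp (-2 * Real.pi * Complex.I * (p.1 j : ℂ))) ∈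
        lambdaFourierRing b m := Algebra.subset_adjoin (Or.inr (Or.inr ⟨j, rfl⟩))
    exact pow_mem h₂ n

lemma lambdaFourierRing_le_range : lambdaFourierRing b m ≤ (toFunction b m).range := by
  classical
  refine Algebra.adjoin_le ?_
  rintro _ (rfl | ⟨j, rfl⟩ | ⟨j, rfl⟩)
  · refine ⟨AddMonoidAlgebra.single 0 ⟨twist (kappa b m), twist_kappa_mem_lamRing b m⟩, ?_⟩
    change toFunction b m _ = _
    rw [toFunction_single, ofAdd_zero, map_one, mul_one]
    rfl
  · refine ⟨AddMonoidAlgebra.single (Pi.single j 1) 1, ?_⟩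
    change toFunction b m _ = _
    rw [toFunction_single, OneMemClass.coe_one, map_one, one_mul]
    funext p
    refine (character_eq_prod _ p.1).trans ?_
    rw [Finset.prod_eq_single j (fun i _ hi => by simp [hi]) (by simp)]
    simp
  · refine ⟨AddMonoidAlgebra.single (Pi.single j (-1)) 1, ?_⟩
    change toFunction b m _ = _
    rw [toFunction_single, OneMemClass.coe_one, map_one, one_mul]
    funext p
    refine (character_eq_prod _ p.1).trans ?_
    rw [Finset.prod_eq_single j (fun i _ hi => by simp [hi]) (by simp)]
    simp [← Complex.exp_neg]

lemma lambdaFourierRing_le_fourierRing : lambdaFourierRing b m ≤ fourierRing b := by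
  classical
  refine Algebra.adjoin_le ?_
  rintro _ (rfl | ⟨j, rfl⟩ | ⟨j, rfl⟩)
  · refine Submodule.subset_span ⟨(-kappa b m, 0), ?_⟩
    funext p
    simp [expFun, lam]
  · refine Submodule.subset_span ⟨(0, Pi.single j 1), ?_⟩
    funext p
    simp [expFun, Pi.single_apply]
  · refine Submodule.subset_span ⟨(0, Pi.single j (-1)), ?_⟩
    funext p
    simp [expFun, Pi.single_apply]

lemma transcendental_twist {t : ℝ} (ht : t ≠ 0) : Transcendental ℂ (twist t) := by
  rw [transcendental_iff]
  intro p hp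
  have hinj : Function.Injective fun (n : ℕ) (_ : Unit) => (n : ℤ) := fun n n' hn => by
    simpa using congrFun hn ()
  have h := (linearIndependent_character (I := Unit)).comp _ hinj
  rw [linearIndependent_iff'] at h
  ext n
  by_contra hn
  refine hn (h p.support p.coeff ?_ n (Polynomial.mem_support_iff.mpr hn))
  funext x
  -- At `c = -x / t` the powers of `twist t` become the characters of `ℝ` with exponents `n`.
  have hx := congrFun hp (-x () / t)
  rw [Polynomial.aeval_def, Polynomial.eval₂_eq_sum, Polynomial.sum_def, Finset.sum_apply] at hx
  rw [Pi.zero_apply] at hx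
  rw [Finset.sum_apply, Pi.zero_apply, ← hx]
  refine Finset.sum_congr rfl fun n _ => ?_
  rw [← Algebra.smul_def, ← twist_natCast_mul]
  simp only [Pi.smul_apply, Function.comp_apply, character, twist]
  congr 2
  push_cast
  have : (t : ℂ) ≠ 0 := by exact_mod_cast ht
  simp
  field_simp

lemma transcendental_lamRing (ht : kappa b m ≠ 0) : Transcendental ℂ
    (⟨twist (kappa b m), twist_kappa_mem_lamRing b m⟩ : lamRing b m) := by
  intro h
  exact transcendental_twist ht (h.algHom (lamRing b m).val)

end Model

/-! ### The affine Weyl group acting on exponents -/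

section Invariants

variable {ι V : Type*} [NormedAddCommGroup V] [InnerProductSpace ℝ V]
  {P : RootPairing ι ℝ V V} [P.IsRootSystem] (b : P.Base) (m : b.support → ℕ)

lemma IsEuclidean.coordMap_reflection [DecidableEq b.support] (hP : IsEuclidean P)
    (r : b.support) (p : Coord b) :
    coordMap b m (P.reflection r) p =
      (fun j => p.1 j - if j = r then ⟪P.root r, point b m p⟫ else 0, p.2) := by
  refine Prod.ext (funext fun j => ?_) rfl
  have h₁ : P.reflection r (point b m p) - p.2 • weight b m =
      ∑ j, p.1 j • P.coroot j - ⟪P.root r, point b m p⟫ • P.coroot r := by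
    rw [hP.reflection_eq', point]
    abel
  change b.toCoweightBasis.coord j (P.reflection r (point b m p) - p.2 • weight b m) = _
  rw [h₁, hP.coord_eq_inner b]
  simp [inner_sub_right, inner_sum, inner_smul_right, inner_fundamentalWeight_coroot hP]

omit [P.IsRootSystem] in
lemma reflection_mem_affineWeylGroup (r : b.support) :
    (P.reflection r : V → V) ∈ affineWeylGroup b :=
  ⟨P.reflection r, Subgroup.subset_closure ⟨r, rfl⟩, 0, fun v => by simp⟩

variable [P.IsCrystallographic]

/-- The action of a simple reflection on the coordinates of a weight. -/
def reflectWeight (r : b.support) (k : b.support → ℤ) : b.support → ℤ :=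
  fun j => k j - k r * P.pairingIn ℤ r j

omit [P.IsRootSystem] in
lemma reflectWeight_involutive (r : b.support) : Function.Involutive (reflectWeight b r) := by
  intro k
  funext j
  simp only [reflectWeight, RootPairing.pairingIn_same]
  ring

/-- The reflection moves `c ω` as well, by `-c (ω, α_r) α_r^∨`. This shift of the coordinate `x_r`
is the source of the factor in `c`. -/
lemma IsEuclidean.character_coordMap_reflection (hP : IsEuclidean P) (r : b.support)
    (k : b.support → ℤ) (p : Coord b) :
    character k (coordMap b m (P.reflection r) p).1 =
      twist (k r * ⟪weight b m, P.root r⟫) p.2 * character (reflectWeight b r k) p.1 := by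
  classical
  rw [hP.coordMap_reflection, character, twist, character, ← Complex.exp_add]
  congr 1
  have h₁ : ⟪P.root r, point b m p⟫ =
      p.2 * ⟪weight b m, P.root r⟫ + ∑ j : b.support, P.pairingIn ℤ r j * p.1 j := by
    rw [point, inner_add_right, inner_smul_right, inner_sum, real_inner_comm]
    congr 1
    refine Finset.sum_congr rfl fun j _ => ?_
    rw [inner_smul_right, hP.inner_root_coroot, ← P.algebraMap_pairingIn ℤ, eq_intCast, mul_comm]
  have h₂ : ∑ j, (k j : ℝ) * (p.1 j - if j = r then ⟪P.root r, point b m p⟫ else 0) =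
      -(k r * ⟪weight b m, P.root r⟫ * p.2) + ∑ j, (reflectWeight b r k j : ℝ) * p.1 j := by
    simp only [mul_sub, reflectWeight, Finset.sum_sub_distrib, mul_ite, mul_zero,
      Finset.sum_ite_eq', Finset.mem_univ, if_true, h₁, mul_add, Int.cast_sub, Int.cast_mul,
      sub_mul, Finset.mul_sum, mul_assoc]
    ring
  simp only
  rw [h₂]
  push_cast
  ring

/-- The support of an invariant `λ`-Fourier polynomial is stable under the simple reflections. -/
lemma IsEuclidean.coeff_reflectWeight_ne_zero (hP : IsEuclidean P) (r : b.support)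
    {F : AddMonoidAlgebra (lamRing b m) (b.support → ℤ)}
    (hF : toFunction b m F ∘ coordMap b m (P.reflection r) = toFunction b m F)
    {k : b.support → ℤ} (hk : F.coeff k ≠ 0) : F.coeff (reflectWeight b r k) ≠ 0 := by
  classical
  rw [coeffAt_eq_zero_iff] at hk ⊢
  obtain ⟨c, hc⟩ := hk
  refine ⟨c, ?_⟩
  set a := coeffAt b m c F with ha
  -- The coefficients of the reflected function. They are compared at a fixed `c`, since for `l r <
  -- 0` the twist may be a negative power of `λ`, outside `ℂ[λ]`.
  set a' : (b.support → ℤ) →₀ ℂ := ∑ l ∈ a.support, Finsupp.single (reflectWeight b r l)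
    (a l * twist (l r * ⟪weight b m, P.root r⟫) c) with ha'
  have haa' : a' = a := by
    refine (linearIndependent_character (I := b.support)).finsuppLinearCombination_injective ?_
    funext x
    have h₁ := congrFun hF (x, c)
    rw [Function.comp_apply, toFunction_apply, toFunction_apply] at h₁
    change Finsupp.linearCombination ℂ character a _ = Finsupp.linearCombination ℂ character a x
      at h₁
    rw [← h₁, ha', map_sum, Finsupp.linearCombination_apply, Finsupp.sum, Finset.sum_apply,
      Finset.sum_apply]
    refine Finset.sum_congr rfl fun l _ => ?_
    rw [Finsupp.linearCombination_single, Pi.smul_apply, Pi.smul_apply,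
      hP.character_coordMap_reflection, smul_eq_mul, smul_eq_mul, mul_assoc]
  rw [← haa', ha', Finsupp.finsetSum_apply, Finset.sum_eq_single k]
  · rw [Finsupp.single_eq_same]
    exact mul_ne_zero hc (Complex.exp_ne_zero _)
  · intro l _ hl
    exact Finsupp.single_eq_of_ne fun h => hl ((reflectWeight_involutive b r).injective h).symm
  · intro h
    exact absurd (Finsupp.mem_support_iff.mpr hc) h

omit [P.IsCrystallographic] in
lemma toFunction_algebraMap (d : lamRing b m) :
    toFunction b m (algebraMap _ _ d) = sndHom b d := by
  rw [AddMonoidAlgebra.coe_algebraMap, Function.comp_apply, Algebra.algebraMap_self,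
    RingHom.id_apply, toFunction_single, ofAdd_zero, map_one, mul_one]

/-- The elements of the group algebra which are invariant under the affine Weyl group. -/
def invariants : Subalgebra (lamRing b m) (AddMonoidAlgebra (lamRing b m) (b.support → ℤ)) where
  carrier := {F | ∀ g ∈ affineWeylGroup b, toFunction b m F ∘ coordMap b m g = toFunction b m F}
  mul_mem' := by
    intro F G hF hG g hg
    rw [map_mul, Pi.mul_comp, hF g hg, hG g hg]
  add_mem' := by
    intro F G hF hG g hg
    rw [map_add, Pi.add_comp, hF g hg, hG g hg]
  algebraMap_mem' := by
    intro d g _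
    rw [toFunction_algebraMap]
    rfl

end Invariants

/-! ### Invariance and leading terms of the `y_j` -/

section Generators

variable {ι V : Type*} [NormedAddCommGroup V] [InnerProductSpace ℝ V]
  {P : RootPairing ι ℝ V V} [P.IsRootSystem] (b : P.Base) (m : b.support → ℕ)

lemma coordMap_snd (g : V → V) (p : Coord b) : (coordMap b m g p).2 = p.2 := rfl

/-- The generators are invariant under the affine Weyl group. -/
lemma IsEuclidean.basicGenerator_comp [Finite ι] (hP : IsEuclidean P) (j : b.support)
    {g : V → V} (hg : g ∈ affineWeylGroup b) :
    basicGenerator b m j ∘ coordMap b m g = basicGenerator b m j := by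
  obtain ⟨τ, hτ, k, hk⟩ := hg
  funext p
  rw [Function.comp_apply, basicGenerator, basicGenerator, coordMap_snd, orbitSum, orbitSum,
    point_coordMap]
  congr 2
  refine Fintype.sum_equiv (Equiv.mulRight (⟨τ, hτ⟩ : weylGroup b)) _ _ fun σ => ?_
  -- Translations by the coroot lattice change the exponent by an integer multiple of `2πi`; the
  -- linear part only reindexes the sum over `W`.
  obtain ⟨z, hz⟩ : ∃ z : ℤ,
      ⟪fundamentalWeight b j, (σ : V ≃ₗ[ℝ] V) (∑ i, (k i : ℝ) • P.coroot i)⟫ = z := by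
    have h : ∀ i : b.support, ∃ z : ℤ,
        ⟪fundamentalWeight b j, (σ : V ≃ₗ[ℝ] V) (P.coroot i)⟫ = z := by
      intro i
      obtain ⟨l, -, hl⟩ := hP.weylGroup_coroot_mem b σ.2 i
      rw [← hl]
      exact hP.exists_int_inner_coroot b j l
    choose z hz using h
    refine ⟨∑ i, k i * z i, ?_⟩
    simp [map_sum, inner_sum, inner_smul_right, hz]
  rw [hk, map_add, inner_add_right, hz, Complex.ofReal_add, mul_add, Complex.exp_add,
    Complex.ofReal_intCast, mul_comm _ (z : ℂ), Complex.exp_int_mul_two_pi_mul_I, mul_one]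
  rfl

variable {b} in
/-- The height of a weight with given coordinates. -/
def height (c : b.support → ℤ) : (b.support → ℤ) →+ ℤ where
  toFun k := ∑ j, k j * c j
  map_zero' := by simp
  map_add' k l := by simp [add_mul, Finset.sum_add_distrib]

omit [P.IsRootSystem] in
variable {b} in
lemma height_apply (c k : b.support → ℤ) : height c k = ∑ j, k j * c j := rfl

variable [P.IsCrystallographic]

omit [P.IsRootSystem] in
-- Each simple root has height 2, so only the empty sum fails to have positive height. Applied to
-- `ω_j - σ⁻¹ ω_j`, the case `v = 0` singles out the stabilizer of `ω_j`.
lemma IsEuclidean.exists_weight_of_mem_closure (hP : IsEuclidean P) {c : b.support → ℤ}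
    (hc : ∀ r : b.support, ∑ j : b.support, P.pairingIn ℤ r j * c j = 2) {v : V}
    (hv : v ∈ AddSubmonoid.closure (Set.range fun j : b.support => P.root j)) :
    ∃ z : b.support → ℤ, (∀ r : b.support, ⟪v, P.coroot r⟫ = z r) ∧ (v = 0 ∨ 0 < height c z) := by
  induction hv using AddSubmonoid.closure_induction with
  | mem x hx =>
    obtain ⟨r, rfl⟩ := hx
    refine ⟨fun j => P.pairingIn ℤ r j, fun j => ?_, Or.inr ?_⟩
    · rw [hP.inner_root_coroot, ← P.algebraMap_pairingIn ℤ, eq_intCast]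
    · rw [height_apply, hc]
      norm_num
  | zero => exact ⟨0, by simp, Or.inl rfl⟩
  | add x y _ _ hx hy =>
    obtain ⟨z, hz, hx⟩ := hx
    obtain ⟨z', hz', hy⟩ := hy
    refine ⟨z + z', fun r => by rw [inner_add_left, hz, hz', Pi.add_apply, Int.cast_add], ?_⟩
    obtain rfl | hx := hx
    · have h₀ : z = 0 := funext fun r => by
        have := hz r
        rw [inner_zero_left] at this
        exact_mod_cast this.symm
      simpa [h₀] using hy
    · obtain rfl | hy := hy
      · have h₀ : z' = 0 := funext fun r => by
          have := hz' r
          rw [inner_zero_left] at this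
          exact_mod_cast this.symm
        simpa [h₀] using Or.inr hx
      · exact Or.inr (by rw [map_add]; exact add_pos hx hy)

lemma IsEuclidean.exists_nat_inner_of_mem_closure [P.IsIrreducible] (hP : IsEuclidean P) {v : V}
    (hv : v ∈ AddSubmonoid.closure (Set.range fun j : b.support => P.root j)) :
    ∃ n : ℕ, ⟪weight b m, v⟫ = n * kappa b m := by
  induction hv using AddSubmonoid.closure_induction with
  | mem x hx =>
    obtain ⟨r, rfl⟩ := hx
    exact hP.exists_nat_inner_weight_root b m r
  | zero => exact ⟨0, by simp⟩
  | add x y _ _ hx hy =>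
    obtain ⟨n, hn⟩ := hx
    obtain ⟨n', hn'⟩ := hy
    exact ⟨n + n', by rw [inner_add_right, hn, hn']; push_cast; ring⟩

/-- The generators are `λ`-Fourier polynomials with leading terms the fundamental weights. -/
theorem IsEuclidean.exists_toFunction_eq_basicGenerator [Finite ι] [P.IsReduced] [P.IsIrreducible]
    [DecidableEq b.support] (hP : IsEuclidean P) {c : b.support → ℤ}
    (hc : ∀ r : b.support, ∑ j : b.support, P.pairingIn ℤ r j * c j = 2) (j : b.support) :
    ∃ Y : AddMonoidAlgebra (lamRing b m) (b.support → ℤ),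
      toFunction b m Y = basicGenerator b m j ∧
      HasLeadingTerm (height c) Y (Pi.single j 1) := by
  classical
  set ω := fundamentalWeight b j with hω
  have hmem : ∀ σ : weylGroup b, ω - (σ : V ≃ₗ[ℝ] V)⁻¹ ω ∈
      AddSubmonoid.closure (Set.range fun j : b.support => P.root j) := by
    intro σ
    refine hP.sub_weylGroup_mem_closure b (k := Pi.single j 1) (fun i => ?_) (inv_mem σ.2)
    rw [inner_fundamentalWeight_coroot hP, Pi.single_apply]
    simp [eq_comm]
  choose z hz hz' using fun σ => hP.exists_weight_of_mem_closure b hc (hmem σ)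
  choose n hn using fun σ => hP.exists_nat_inner_of_mem_closure b m (hmem σ)
  set d : weylGroup b → lamRing b m := fun σ => ⟨twist (n σ * kappa b m), twist_mem_lamRing b m _⟩
    with hd
  set s : Finset (weylGroup b) := {σ | (σ : V ≃ₗ[ℝ] V) ω = ω} with hs
  have hcard : Nat.card {σ : weylGroup b // (σ : V ≃ₗ[ℝ] V) ω = ω} = s.card := by
    rw [Nat.card_eq_fintype_card, Fintype.card_subtype]
  have hcard₀ : (s.card : ℂ) ≠ 0 := by
    rw [Nat.cast_ne_zero, Finset.card_ne_zero]
    exact ⟨1, by simp [hs]⟩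
  have hfix : ∀ σ : weylGroup b, (σ : V ≃ₗ[ℝ] V) ω = ω ↔ ω - (σ : V ≃ₗ[ℝ] V)⁻¹ ω = 0 := by
    intro σ
    rw [sub_eq_zero]
    constructor <;> intro h
    · nth_rw 2 [← h]
      exact ((σ : V ≃ₗ[ℝ] V).symm_apply_apply ω).symm
    · nth_rw 1 [h]
      exact (σ : V ≃ₗ[ℝ] V).apply_symm_apply ω
  refine ⟨(1 / (s.card : ℂ)) • ∑ σ, AddMonoidAlgebra.single (Pi.single j 1 - z σ) (d σ), ?_, ?_⟩
  · funext p
    rw [map_smul, map_sum, Pi.smul_apply, Finset.sum_apply, basicGenerator, orbitSum, hcard,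
      smul_eq_mul, mul_left_comm]
    congr 1
    rw [Finset.mul_sum]
    refine Finset.sum_congr rfl fun σ _ => ?_
    -- The part linear in `c` is `(σ⁻¹ ω_j, ω) = θ_j - n κ`; the twist by `θ_j` cancels its first
    -- term and leaves `λ ^ n`.
    have h₁ : ⟪ω, (σ : V ≃ₗ[ℝ] V) (point b m p)⟫ = (theta b m j - n σ * kappa b m) * p.2 +
        ∑ i, (((Pi.single j 1 : b.support → ℤ) - z σ) i : ℤ) * p.1 i := by
      rw [hP.inner_weylGroup_inv b σ.2, point, inner_add_right, inner_smul_right, inner_sum, ← hn,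
        inner_sub_right, theta, real_inner_comm ω, real_inner_comm _ (weight b m)]
      congr 1
      · ring
      · refine Finset.sum_congr rfl fun i _ => ?_
        have h₂ := hz σ i
        rw [inner_sub_left, inner_fundamentalWeight_coroot hP] at h₂
        rw [inner_smul_right, mul_comm, Pi.sub_apply, Int.cast_sub, ← h₂, Pi.single_apply]
        congr 1
        by_cases hij : i = j
        · simp [hij]
        · simp [hij, Ne.symm hij]
    rw [toFunction_single, Pi.mul_apply, sndHom_apply]
    change Complex.exp _ * Complex.exp _ = _
    rw [← Complex.exp_add, ← Complex.exp_add, h₁]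
    congr 1
    simp only [toAdd_ofAdd]
    push_cast
    ring
  · rw [HasLeadingTerm]
    -- The leading monomial is written as an average over the stabilizer, to be subtracted term by
    -- term.
    have h₁ : AddMonoidAlgebra.single (Pi.single j 1 : b.support → ℤ) (1 : lamRing b m) =
        (1 / (s.card : ℂ)) •
        ∑ σ : weylGroup b, if (σ : V ≃ₗ[ℝ] V) ω = ω then
          AddMonoidAlgebra.single (Pi.single j 1 : b.support → ℤ) (1 : lamRing b m) else 0 := by
      rw [← Finset.sum_filter, Finset.sum_const, ← Nat.cast_smul_eq_nsmul ℂ, smul_smul,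
        one_div_mul_cancel hcard₀, one_smul]
    rw [h₁, ← smul_sub, ← Finset.sum_sub_distrib]
    refine Submodule.smul_of_tower_mem _ _ (sum_mem fun σ _ => ?_)
    split_ifs with h
    · have h₂ := (hfix σ).mp h
      have h₃ : z σ = 0 := funext fun r => by
        have := hz σ r
        rw [h₂, inner_zero_left] at this
        exact_mod_cast this.symm
      have h₄ : d σ = 1 := by
        apply Subtype.ext
        simp only [hd]
        rw [← hn, h₂, inner_zero_right, twist_zero]
        rfl
      rw [h₃, h₄, sub_zero, sub_self]
      exact zero_mem _
    · rw [sub_zero]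
      refine single_mem_lowerSubmodule _ ?_
      have := (hz' σ).resolve_left fun h₂ => h ((hfix σ).mpr h₂)
      rw [map_sub]
      lia

end Generators

/-! ### Dominance of the highest exponents and the main theorem -/

section Main

variable {ι V : Type*} [Finite ι] [NormedAddCommGroup V] [InnerProductSpace ℝ V]
  {P : RootPairing ι ℝ V V} [P.IsRootSystem] [P.IsCrystallographic] [P.IsReduced]
  (b : P.Base) (m : b.support → ℕ)

omit [Finite ι] [P.IsRootSystem] [P.IsCrystallographic] [P.IsReduced] in
lemma sum_smul_single [DecidableEq b.support] (k : b.support →₀ ℕ) :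
    (k.sum fun i n => n • (Pi.single i 1 : b.support → ℤ)) = fun i => (k i : ℤ) := by
  funext j
  rw [Finsupp.sum_fintype _ _ (by simp), Finset.sum_apply,
    Finset.sum_eq_single j (fun i _ hi => by simp [hi.symm]) (by simp)]
  simp

omit [P.IsReduced] in
/-- The exponents of maximal height of an invariant `λ`-Fourier polynomial are dominant. -/
lemma IsEuclidean.exists_eq_sum_of_mem_invariants [DecidableEq b.support] (hP : IsEuclidean P)
    {c : b.support → ℤ} (hc : ∀ r : b.support, ∑ j : b.support, P.pairingIn ℤ r j * c j = 2)
    {F : AddMonoidAlgebra (lamRing b m) (b.support → ℤ)} (hF : F ∈ invariants b m)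
    {k : b.support → ℤ} (hk : F.coeff k ≠ 0)
    (hmax : ∀ l, F.coeff l ≠ 0 → height c l ≤ height c k) :
    ∃ l : b.support →₀ ℕ, k = l.sum fun i n => n • (Pi.single i 1 : b.support → ℤ) := by
  have hnonneg : ∀ r, 0 ≤ k r := by
    intro r
    have h₁ := hmax _ (hP.coeff_reflectWeight_ne_zero b m r
      (hF _ (reflection_mem_affineWeylGroup b r)) hk)
    -- Since `α_r` has height 2, reflection lowers the height by `2 k_r`; maximality then forces
    -- `k_r ≥ 0`.
    have h₂ : height c (reflectWeight b r k) = height c k - k r * 2 := by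
      rw [height_apply, height_apply, ← hc r, Finset.mul_sum, ← Finset.sum_sub_distrib]
      exact Finset.sum_congr rfl fun j _ => by rw [reflectWeight]; ring
    lia
  refine ⟨Finsupp.equivFunOnFinite.symm fun i => (k i).toNat, ?_⟩
  rw [sum_smul_single]
  funext i
  exact (Int.toNat_of_nonneg (hnonneg i)).symm

end Main

end LambdaFourier

end

theorem mainTheorem5 {ι V : Type*} [Finite ι] [NormedAddCommGroup V] [InnerProductSpace ℝ V]
    (P : RootPairing ι ℝ V V) [P.IsRootSystem] [P.IsCrystallographic] [P.IsReduced]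
    [P.IsIrreducible] (hP : LambdaFourier.IsEuclidean P) (b : P.Base) (m : b.support → ℕ) :
    LambdaFourier.invariantLambdaFourierRing b m =
      Algebra.adjoin ℂ
        (Set.range (LambdaFourier.basicGenerator b m) ∪ {LambdaFourier.lam b m}) ∧
    AlgebraicIndependent ℂ (LambdaFourier.basicGenerator b m) ∧
    (m ≠ 0 → AlgebraicIndependent ℂ
      (fun o : Option b.support =>
        o.elim (LambdaFourier.lam b m) (LambdaFourier.basicGenerator b m))) := by
  open LambdaFourier in
  classical
  obtain ⟨c, hc₁, hc₂⟩ := hP.exists_height b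
  choose Y hY hlead using hP.exists_toFunction_eq_basicGenerator b m hc₂
  -- Independence over `ℂ[λ]` serves both claims: by restriction of scalars for the `y_j` alone, and
  -- by transitivity once `λ` is adjoined.
  have hindep : AlgebraicIndependent (lamRing b m) Y := by
    refine algebraicIndependent_of_hasLeadingTerm hlead fun k l hkl => ?_
    simp only [sum_smul_single] at hkl
    ext i
    exact_mod_cast congrFun hkl i
  have hYfun : basicGenerator b m = toFunction b m ∘ Y := funext fun j => (hY j).symm
  refine ⟨le_antisymm ?_ (Algebra.adjoin_le ?_), ?_, fun hm => ?_⟩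
  · rintro f ⟨hf, -, hinv⟩
    obtain ⟨F, rfl⟩ := lambdaFourierRing_le_range b m hf
    have hF : F ∈ Algebra.adjoin (lamRing b m) (Set.range Y) := by
      refine le_adjoin_of_hasLeadingTerm hlead (fun i => ?_) (invariants b m) (fun i => ?_)
        (fun F hF k hk hmax => hP.exists_eq_sum_of_mem_invariants b m hc₂ hF hk hmax) hinv
      · rw [height_apply, Finset.sum_eq_single i (fun j _ hj => by simp [hj]) (by simp)]
        simpa using zero_le_one.trans (hc₁ i)
      · intro g hg
        rw [hY]
        exact hP.basicGenerator_comp b m i hg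
    change toFunction b m F ∈ _
    clear hf hinv
    induction hF using Algebra.adjoin_induction with
    | mem x hx =>
      obtain ⟨i, rfl⟩ := hx
      rw [hY]
      exact Algebra.subset_adjoin (Or.inl ⟨i, rfl⟩)
    | algebraMap d =>
      rw [toFunction_algebraMap]
      exact sndHom_mem_adjoin b m _ (Or.inr rfl) d
    | add x y _ _ hx hy => rw [map_add]; exact add_mem hx hy
    | mul x y _ _ hx hy => rw [map_mul]; exact mul_mem hx hy
  · rintro _ (⟨j, rfl⟩ | rfl)
    · have h : basicGenerator b m j ∈ lambdaFourierRing b m := hY j ▸ toFunction_mem b m (Y j)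
      exact ⟨h, lambdaFourierRing_le_fourierRing b m h, fun g hg => hP.basicGenerator_comp b m j hg⟩
    · have h : lam b m ∈ lambdaFourierRing b m := Algebra.subset_adjoin (Or.inl rfl)
      exact ⟨h, lambdaFourierRing_le_fourierRing b m h, fun g _ => rfl⟩
  · rw [hYfun]
    exact (hindep.restrictScalars (algebraMap ℂ (lamRing b m)).injective).map'
      (toFunction_injective b m)
  · have hlam : AlgebraicIndependent ℂ fun _ : Unit =>
        (⟨twist (kappa b m), twist_kappa_mem_lamRing b m⟩ : lamRing b m) :=
      algebraicIndependent_unique_type_iff.mpr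
        (transcendental_lamRing b m (hP.kappa_mem b hm).1.ne')
    have h := ((hlam.sumElim_comp hindep).map' (toFunction_injective b m)).comp
      (Equiv.optionEquivSumPUnit b.support) (Equiv.injective _)
    convert h using 1
    funext o
    cases o with
    | none =>
      change _ = toFunction b m (algebraMap _ _ _)
      rw [toFunction_algebraMap]
      rfl
    | some j => exact (hY j).symm
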